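/- Let $\gamma = (3-\sqrt5)/2$, let $a_0 = 0$ and $a_i = \lfloor (i+1)\gamma\rfloor - \lfloor i\gamma\rfloor$ for $i \ge 1$ (so that $a_1a_2a_3\cdots = 01001010\cdots$ is the infinite Fibonacci word), and let $\mathcal{A}_\gamma = (a_{k+\ell})_{k,\ell\ge 0}$ be the infinite Fibonacci matrix. Let $m, n$ be natural numbers such that $\max(m,n)$ is a Fibonacci number. Then the $m\times n$ blocks (contiguous submatrices) of $\mathcal{A}_\gamma$ are balanced with respect to each other; that is, there are at most two distinct values among the entry sums $$T(i,m,n) = \sum_{k=0}^{m-1}\sum_{\ell=0}^{n-1} a_{i+k+\ell}\qquad (i\ge 0).$$ -/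

import Mathlib

noncomputable section

/-- The Sturmian word `(a_i)_{i ≥ 0}` of slope `α`: `a_i = ⌊(i+1)α⌋ - ⌊iα⌋` for `i ≥ 1`,
and `a_0 = 0`. -/
def sturmianWord (α : ℝ) (i : ℕ) : ℤ :=
  if i = 0 then 0 else ⌊((i : ℝ) + 1) * α⌋ - ⌊(i : ℝ) * α⌋

/-- The infinite matrix `(a_{k+ℓ})_{k,ℓ ≥ 0}` of a sequence `(a_i)_{i ≥ 0}`. -/
def hankelMatrix (a : ℕ → ℤ) : Matrix ℕ ℕ ℤ :=
  Matrix.of fun k l => a (k + l)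

/-- The Sturmian matrix `𝒜_α`. -/
def sturmianMatrix (α : ℝ) : Matrix ℕ ℕ ℤ :=
  hankelMatrix (sturmianWord α)

/-- The `m × n` block (contiguous submatrix) of an infinite matrix whose upper left corner is at
position `(p, q)`. -/
def matrixBlock (A : Matrix ℕ ℕ ℤ) (p q m n : ℕ) : Matrix (Fin m) (Fin n) ℤ :=
  A.submatrix (fun k : Fin m => p + (k : ℕ)) (fun l : Fin n => q + (l : ℕ))

/-- The sum of all entries of a finite matrix. -/
def entrySum {m n : ℕ} (B : Matrix (Fin m) (Fin n) ℤ) : ℤ :=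
  ∑ k, ∑ l, B k l

/-- The `m × n` blocks of `A` are balanced with respect to each other: at most two distinct values
occur among their entry sums. -/
def BlocksBalanced (A : Matrix ℕ ℕ ℤ) (m n : ℕ) : Prop :=
  {s : ℤ | ∃ p q : ℕ, s = entrySum (matrixBlock A p q m n)}.encard ≤ 2

/-- The number `γ = (3 - √5) / 2`. -/
def fibSlope : ℝ := (3 - Real.sqrt 5) / 2

/-- In the matrix of a sequence, the entry sum of a block depends only on the index sum `i = p + q`
of its upper left corner, and it is `T(i, m, n) = ∑_{k < m} ∑_{ℓ < n} a_{i+k+ℓ}`. -/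
theorem entrySum_matrixBlock_hankelMatrix (a : ℕ → ℤ) (p q m n : ℕ) :
    entrySum (matrixBlock (hankelMatrix a) p q m n) =
      ∑ k ∈ Finset.range m, ∑ l ∈ Finset.range n, a ((p + q) + k + l) := by
  simp only [entrySum, matrixBlock, hankelMatrix, Matrix.submatrix_apply, Matrix.of_apply,
    Finset.sum_range]
  refine Finset.sum_congr rfl fun k _ => Finset.sum_congr rfl fun l _ => ?_
  congr 1
  omega

end

/-!
Let `‖x‖` be the distance from `x` to the nearest integer, which is the norm of `UnitAddCircle`,
and let `ε` be the signed error `nα - round (nα)`, so that `|ε| = ‖nα‖`. The sum of `n` consecutive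
letters of the Sturmian word starting at `j` is `⌊(j + n)α⌋ - ⌊jα⌋`, that is, the constant
`round (nα)` plus the jump `⌊jα + ε⌋ - ⌊jα⌋`, which is `0` or `sign ε`. If the jumps at `j` and at
`j + d` are both nonzero, then `‖dα‖ < ‖nα‖`. So if `‖nα‖ ≤ ‖dα‖` for `0 < d < m`, at most one of
the `m` jumps in a block sum is nonzero, and only two block sums can occur.

For `γ`, the law of best approximation gives `‖F_t γ‖ ≤ ‖dγ‖` for all `0 < d < F_{t+1}`. Since `γ`
is an integer minus the golden ratio `φ`, the signed errors at Fibonacci numbers are the powers of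
the conjugate `ψ = 1 - φ`, which alternate in sign.
-/

theorem blocksBalanced_hankelMatrix {a : ℕ → ℤ} {m n : ℕ} {c d : ℤ}
    (h : ∀ i, ∑ k ∈ Finset.range m, ∑ l ∈ Finset.range n, a (i + k + l) ∈ ({c, d} : Set ℤ)) :
    BlocksBalanced (hankelMatrix a) m n := by
  have hsub : {s : ℤ | ∃ p q : ℕ, s = entrySum (matrixBlock (hankelMatrix a) p q m n)} ⊆
      {c, d} := by
    rintro _ ⟨p, q, rfl⟩
    rw [entrySum_matrixBlock_hankelMatrix]
    exact h (p + q)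
  calc _ ≤ ({c, d} : Set ℤ).encard := Set.encard_le_encard hsub
    _ ≤ ({d} : Set ℤ).encard + 1 := Set.encard_insert_le _ _
    _ = 2 := by rw [Set.encard_singleton, one_add_one_eq_two]

theorem entrySum_matrixBlock_transpose (A : Matrix ℕ ℕ ℤ) (p q m n : ℕ) :
    entrySum (matrixBlock A.transpose p q m n) = entrySum (matrixBlock A q p n m) :=
  Finset.sum_comm

theorem BlocksBalanced.transpose {A : Matrix ℕ ℕ ℤ} {m n : ℕ} (h : BlocksBalanced A m n) :
    BlocksBalanced A.transpose n m := by
  have hsums : {s : ℤ | ∃ p q : ℕ, s = entrySum (matrixBlock A.transpose p q n m)} =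
      {s : ℤ | ∃ p q : ℕ, s = entrySum (matrixBlock A p q m n)} := by
    simp only [entrySum_matrixBlock_transpose]
    exact Set.ext fun _ => exists_comm
  exact (congrArg Set.encard hsums).trans_le h

theorem hankelMatrix_transpose (a : ℕ → ℤ) : (hankelMatrix a).transpose = hankelMatrix a := by
  ext k l
  simp only [hankelMatrix, Matrix.transpose_apply, Matrix.of_apply, add_comm]

section OrderedRing

variable {R : Type*} [CommRing R] [LinearOrder R] [IsStrictOrderedRing R]

theorem floor_add_sub_floor_mem [FloorRing R] {ε : R} (hε : |ε| < 1) (x : R) :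
    ⌊x + ε⌋ - ⌊x⌋ ∈ ({0, (SignType.sign ε : ℤ)} : Set ℤ) := by
  obtain ⟨hε₁, hε₂⟩ := abs_lt.1 hε
  have lower : ⌊x⌋ - 1 ≤ ⌊x + ε⌋ := by
    rw [← Int.floor_sub_one]
    exact Int.floor_mono (by linarith)
  have upper : ⌊x + ε⌋ ≤ ⌊x⌋ + 1 := by
    rw [← Int.floor_add_one]
    exact Int.floor_mono (by linarith)
  rcases lt_trichotomy ε 0 with hneg | rfl | hpos
  · have : ⌊x + ε⌋ ≤ ⌊x⌋ := Int.floor_mono (by linarith)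
    rw [sign_neg hneg, SignType.coe_neg_one, Set.mem_insert_iff, Set.mem_singleton_iff]
    omega
  · simp
  · have : ⌊x⌋ ≤ ⌊x + ε⌋ := Int.floor_mono (by linarith)
    rw [sign_pos hpos, SignType.coe_one, Set.mem_insert_iff, Set.mem_singleton_iff]
    omega

theorem abs_le_abs_add_of_mul_nonneg {a b : R} (h : 0 ≤ a * b) : |a| ≤ |a + b| :=
  sq_le_sq.1 (by nlinarith [sq_nonneg b])

-- As the determinant is `±1`, `(d, r) = x (q, p) + y (q', p')` with integers `x` and `y`. The
-- bounds on `d` force `x ≠ 0` and `x y ≤ 0`, so the errors `x (qα - p)` and `y (q'α - p')` add up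
-- without cancellation.
theorem abs_mul_sub_le_of_isUnit_det {α : R} {p q p' q' : ℤ} (hdet : IsUnit (q * p' - p * q'))
    (hsign : (q * α - p) * (q' * α - p') ≤ 0) (hq : 0 ≤ q) {d : ℤ} (hd : 0 < d) (hdq' : d < q')
    (r : ℤ) : |q * α - p| ≤ |d * α - r| := by
  obtain ⟨x, y, rfl, rfl⟩ : ∃ x y : ℤ, d = x * q + y * q' ∧ r = x * p + y * p' := by
    set u := q * p' - p * q' with hu
    have hu_sq : u * u = 1 := Int.isUnit_mul_self hdet
    exact ⟨u * (d * p' - r * q'), u * (q * r - p * d),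
      by linear_combination (-d) * hu_sq + u * d * hu,
      by linear_combination (-r) * hu_sq + u * r * hu⟩
  have hx : x ≠ 0 := by
    rintro rfl
    have : 0 < y := by nlinarith
    nlinarith
  have hxy : x * y ≤ 0 := by
    by_contra! hpos
    rcases pos_and_pos_or_neg_and_neg_of_mul_pos hpos with ⟨hx, hy⟩ | ⟨hx, hy⟩ <;> nlinarith
  have no_cancel : 0 ≤ (x * (q * α - p)) * (y * (q' * α - p')) := by
    rw [mul_mul_mul_comm]
    exact mul_nonneg_of_nonpos_of_nonpos (by exact_mod_cast hxy) hsign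
  calc |q * α - p| ≤ |(x : R)| * |q * α - p| :=
        le_mul_of_one_le_left (abs_nonneg _) (by exact_mod_cast Int.one_le_abs hx)
    _ = |x * (q * α - p)| := (abs_mul _ _).symm
    _ ≤ |x * (q * α - p) + y * (q' * α - p')| := abs_le_abs_add_of_mul_nonneg no_cancel
    _ = |((x * q + y * q' : ℤ) : R) * α - (x * p + y * p' : ℤ)| := by push_cast; ring_nf

end OrderedRing

theorem norm_coe_unitAddCircle_le_abs_sub (x : ℝ) (z : ℤ) : ‖(x : UnitAddCircle)‖ ≤ |x - z| :=
  UnitAddCircle.norm_eq.trans_le (round_le x z)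

theorem norm_coe_sub_lt_of_floor_add_ne {ε x y : ℝ} (hx : ⌊x + ε⌋ ≠ ⌊x⌋) (hy : ⌊y + ε⌋ ≠ ⌊y⌋) :
    ‖((x - y : ℝ) : UnitAddCircle)‖ < |ε| := by
  wlog hε : 0 ≤ ε generalizing ε x y
  · have := this (x := x + ε) (y := y + ε) (ε := -ε) (by simpa using hx.symm)
      (by simpa using hy.symm) (by linarith)
    simpa using this
  have lt_floor {z : ℝ} (hz : ⌊z + ε⌋ ≠ ⌊z⌋) : z < ⌊z + ε⌋ :=
    Int.floor_lt.1 ((Int.floor_mono (le_add_of_nonneg_right hε)).lt_of_ne' hz)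
  -- Both `⌊x + ε⌋ - x` and `⌊y + ε⌋ - y` lie in `(0, ε]`, so they differ by less than `ε`.
  refine (norm_coe_unitAddCircle_le_abs_sub _ (⌊x + ε⌋ - ⌊y + ε⌋)).trans_lt ?_
  rw [abs_of_nonneg hε, abs_lt]
  push_cast
  constructor <;> linarith [lt_floor hx, lt_floor hy, Int.floor_le (x + ε), Int.floor_le (y + ε)]

theorem sum_eq_zero_or_exists_sum_eq {ι M : Type*} [AddCommMonoid M] {s : Finset ι} {f : ι → M}
    (h : (↑s ∩ Function.support f).Subsingleton) :
    ∑ i ∈ s, f i = 0 ∨ ∃ i ∈ s, ∑ j ∈ s, f j = f i := by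
  by_cases hs : ∃ i ∈ s, f i ≠ 0
  · obtain ⟨i, hi, hfi⟩ := hs
    refine .inr ⟨i, hi, Finset.sum_eq_single_of_mem i hi fun j hj hji => ?_⟩
    by_contra hfj
    exact hji (h ⟨hj, hfj⟩ ⟨hi, hfi⟩)
  · push Not at hs
    exact .inl (Finset.sum_eq_zero hs)

section Sturmian

variable {α : ℝ} {m n : ℕ}

theorem sturmianWord_eq_floor_sub_floor (hα : ⌊α⌋ = 0) (i : ℕ) :
    sturmianWord α i = ⌊((i + 1 : ℕ) : ℝ) * α⌋ - ⌊(i : ℝ) * α⌋ := by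
  rw [sturmianWord]
  split_ifs with hi
  · simp [hi, hα]
  · push_cast
    rfl

theorem sum_range_sturmianWord (hα : ⌊α⌋ = 0) (n j : ℕ) :
    ∑ l ∈ Finset.range n, sturmianWord α (j + l) =
      round (n * α) + (⌊j * α + (n * α - round (n * α))⌋ - ⌊j * α⌋) := by
  have telescope : ∑ l ∈ Finset.range n, sturmianWord α (j + l) =
      ⌊((j + n : ℕ) : ℝ) * α⌋ - ⌊j * α⌋ := by
    simp only [sturmianWord_eq_floor_sub_floor hα]
    exact Finset.sum_range_sub (fun l : ℕ => ⌊((j + l : ℕ) : ℝ) * α⌋) n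
  rw [telescope, ← add_sub_assoc (j * α), Int.floor_sub_intCast, Nat.cast_add, add_mul]
  ring

theorem eq_of_floor_add_sub_round_ne
    (h : ∀ d : ℕ, 0 < d → d < m →
      ‖((n * α : ℝ) : UnitAddCircle)‖ ≤ ‖((d * α : ℝ) : UnitAddCircle)‖)
    {j k : ℕ} (hjk : j < k + m) (hkj : k < j + m)
    (hj : ⌊j * α + (n * α - round (n * α))⌋ ≠ ⌊j * α⌋)
    (hk : ⌊k * α + (n * α - round (n * α))⌋ ≠ ⌊k * α⌋) : j = k := by
  wlog hle : k ≤ j generalizing j k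
  · exact (this hkj hjk hk hj (by omega)).symm
  obtain ⟨d, rfl⟩ := Nat.exists_eq_add_of_le hle
  have hlt := norm_coe_sub_lt_of_floor_add_ne hj hk
  rw [← UnitAddCircle.norm_eq, ← sub_mul, Nat.cast_add, add_sub_cancel_left] at hlt
  by_contra hne
  exact hlt.not_ge (h d (by omega) (by omega))

theorem blocksBalanced_sturmianMatrix_of_norm_le (hα : ⌊α⌋ = 0)
    (h : ∀ d : ℕ, 0 < d → d < m →
      ‖((n * α : ℝ) : UnitAddCircle)‖ ≤ ‖((d * α : ℝ) : UnitAddCircle)‖) :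
    BlocksBalanced (sturmianMatrix α) m n := by
  set ε : ℝ := n * α - round (n * α) with hε
  have hε_lt : |ε| < 1 := (abs_sub_round _).trans_lt (by norm_num)
  refine blocksBalanced_hankelMatrix (c := m * round (n * α))
    (d := m * round (n * α) + SignType.sign ε) fun i => ?_
  simp only [sum_range_sturmianWord hα, Finset.sum_add_distrib, Finset.sum_const,
    Finset.card_range, nsmul_eq_mul, Set.mem_insert_iff, Set.mem_singleton_iff, add_eq_left,
    add_right_inj, ← hε]
  have unique_jump : (↑(Finset.range m) ∩ Function.support fun k : ℕ =>
      ⌊((i + k : ℕ) : ℝ) * α + ε⌋ - ⌊((i + k : ℕ) : ℝ) * α⌋).Subsingleton := by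
    rintro k ⟨hk, hk_jump⟩ l ⟨hl, hl_jump⟩
    rw [Finset.coe_range, Set.mem_Iio] at hk hl
    exact Nat.add_left_cancel <| eq_of_floor_add_sub_round_ne h (by omega) (by omega)
      (sub_ne_zero.1 hk_jump) (sub_ne_zero.1 hl_jump)
  rcases sum_eq_zero_or_exists_sum_eq unique_jump with hsum | ⟨k, -, hsum⟩
  · exact .inl hsum
  · rw [hsum]
    exact floor_add_sub_floor_mem hε_lt _

end Sturmian

theorem fibSlope_eq_two_sub_goldenRatio : fibSlope = 2 - Real.goldenRatio := by
  rw [fibSlope, Real.goldenRatio]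
  ring

theorem floor_fibSlope : ⌊fibSlope⌋ = 0 := by
  rw [fibSlope_eq_two_sub_goldenRatio, Int.floor_eq_zero_iff]
  constructor <;> linarith [Real.one_lt_goldenRatio, Real.goldenRatio_lt_two]

theorem fib_mul_fibSlope_sub (t : ℕ) :
    ((Nat.fib t : ℤ) : ℝ) * fibSlope - (2 * Nat.fib t - Nat.fib (t + 1) : ℤ) =
      Real.goldenConj ^ t := by
  rw [← Real.fib_succ_sub_goldenRatio_mul_fib, fibSlope_eq_two_sub_goldenRatio]
  push_cast
  ring

theorem isUnit_fib_succ_sq_sub_fib_mul_fib (t : ℕ) :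
    IsUnit ((Nat.fib (t + 1) : ℤ) ^ 2 - Nat.fib t * Nat.fib (t + 2)) := by
  have cassini : (Nat.fib (t + 2) : ℤ) * Nat.fib t - Nat.fib (t + 1) ^ 2 = (-1) ^ (t + 1) := by
    have := Int.fib_succ_mul_fib_pred_sub_fib_sq (t + 1)
    rwa [add_sub_cancel_right] at this
  rw [mul_comm, ← neg_sub, cassini]
  exact (isUnit_one.neg.pow _).neg

theorem norm_fib_mul_fibSlope_le {t d : ℕ} (hd : 0 < d) (hdt : d < Nat.fib (t + 1)) :
    ‖((Nat.fib t * fibSlope : ℝ) : UnitAddCircle)‖ ≤ ‖((d * fibSlope : ℝ) : UnitAddCircle)‖ := by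
  have hdet : IsUnit ((Nat.fib t : ℤ) * (2 * Nat.fib (t + 1) - Nat.fib (t + 2)) -
      (2 * Nat.fib t - Nat.fib (t + 1)) * Nat.fib (t + 1)) := by
    convert isUnit_fib_succ_sq_sub_fib_mul_fib t using 1
    ring
  have hsign : (((Nat.fib t : ℤ) : ℝ) * fibSlope - (2 * Nat.fib t - Nat.fib (t + 1) : ℤ)) *
      (((Nat.fib (t + 1) : ℤ) : ℝ) * fibSlope -
        (2 * Nat.fib (t + 1) - Nat.fib (t + 2) : ℤ)) ≤ 0 := by
    rw [fib_mul_fibSlope_sub, fib_mul_fibSlope_sub, pow_succ, ← mul_assoc]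
    exact mul_nonpos_of_nonneg_of_nonpos (mul_self_nonneg _) Real.goldenConj_neg.le
  have best := abs_mul_sub_le_of_isUnit_det hdet hsign (Int.natCast_nonneg _)
    (Int.natCast_pos.2 hd) (Int.ofNat_lt.2 hdt) (round (d * fibSlope))
  rw [UnitAddCircle.norm_eq (x := d * fibSlope)]
  exact (norm_coe_unitAddCircle_le_abs_sub _ _).trans best

theorem corollary4_general (m n : ℕ)
    (h : ∃ t : ℕ, (m = Nat.fib t ∨ n = Nat.fib t) ∧ max m n ≤ Nat.fib (t + 1)) :
    BlocksBalanced (sturmianMatrix fibSlope) m n := by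
  obtain ⟨t, hmn, hmax⟩ := h
  have balanced {k : ℕ} (hk : k ≤ Nat.fib (t + 1)) :
      BlocksBalanced (sturmianMatrix fibSlope) k (Nat.fib t) :=
    blocksBalanced_sturmianMatrix_of_norm_le floor_fibSlope fun _ hd hdk =>
      norm_fib_mul_fibSlope_le hd (hdk.trans_le hk)
  obtain ⟨hm, hn⟩ := max_le_iff.1 hmax
  rcases hmn with rfl | rfl
  · rw [sturmianMatrix, ← hankelMatrix_transpose]
    exact (balanced hn).transpose
  · exact balanced hm

theorem corollary4 (m n : ℕ) (h : ∃ t : ℕ, max m n = Nat.fib t) :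
    BlocksBalanced (sturmianMatrix fibSlope) m n := by
  obtain ⟨t, ht⟩ := h
  exact corollary4_general m n ⟨t, (max_choice m n).imp (·.symm.trans ht) (·.symm.trans ht),
    ht.trans_le Nat.fib_le_fib_succ⟩
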